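/- There exists a finite triangle-free graph $H$ such that the $3$-regular tree $T_3$ admits a factor of i.i.d. homomorphism to $H$. Here, fix a root $o\in V(T_3)$ and let $X(T_3)$ be the set of labelings $x:V(T_3)\to 2^\omega$, identified when they differ by an automorphism of $T_3$ fixing $o$. It carries the quotient $\sigma$-algebra and the image of the product over $V(T_3)$ of the coin flip measures on $2^\omega$. Let $S'(T_3)$ be the graph on $X(T_3)$ in which the distinct classes of $x$ and $y$ are adjacent iff there are a neighbor $v$ of $o$ and an automorphism of $T_3$ taking $v$ to $o$ and $x$ to $y$. Let $F(T_3)\subseteq X(T_3)$ be the set of classes whose connected component in $S'(T_3)$ is a $3$-regular tree, with the inherited measure $\mu$, and let $S(T_3)$ be the restriction of $S'(T_3)$ to $F(T_3)$. A factor of i.i.d. homomorphism of $T_3$ to a finite graph $H$ is a graph homomorphism $c$ from $S(T_3)$ to $H$, defined on all of $F(T_3)$, that is $\mu$-measurable (each set $c^{-1}(S)$, $S\subseteq V(H)$, is measurable for the completion of $\mu$). -/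

import Mathlib

open MeasureTheory

noncomputable section

namespace FactorIID

/-- The space `2^ω` of labels, with its product σ-algebra. -/
abbrev Label : Type := ℕ → Bool

/-- The coin flip measure on `2^ω`: countably many independent fair bits. -/
def coinFlip : Measure Label :=
  Measure.infinitePi fun _ : ℕ => (PMF.uniformOfFintype Bool).toMeasure

instance : IsProbabilityMeasure coinFlip := by
  unfold coinFlip; infer_instance

variable {V : Type*}

/-- The i.i.d. labelling of the vertex set `V`: each vertex independently receives a label
distributed according to the coin flip measure. -/
def iidLabeling (V : Type*) : Measure (V → Label) :=
  Measure.infinitePi fun _ : V => coinFlip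

/-- `(T, v, x) ≅ (T, w, y)`: there is an automorphism of `T` that sends the root `v` to the
root `w` and carries the labelling `x` to the labelling `y`. -/
def RootedIso (T : SimpleGraph V) (v : V) (x : V → Label) (w : V) (y : V → Label) : Prop :=
  ∃ φ : T ≃g T, φ v = w ∧ ∀ u, y (φ u) = x u

theorem RootedIso.refl (T : SimpleGraph V) (v : V) (x : V → Label) : RootedIso T v x v x :=
  ⟨RelIso.refl _, rfl, fun _ => rfl⟩

theorem RootedIso.symm {T : SimpleGraph V} {v w : V} {x y : V → Label}
    (h : RootedIso T v x w y) : RootedIso T w y v x := by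
  obtain ⟨φ, hv, hx⟩ := h
  refine ⟨φ.symm, by rw [← hv]; exact φ.symm_apply_apply v, fun u => ?_⟩
  rw [← hx (φ.symm u)]
  exact congrArg y (φ.apply_symm_apply u)

theorem RootedIso.trans {T : SimpleGraph V} {u v w : V} {x y z : V → Label}
    (h : RootedIso T u x v y) (k : RootedIso T v y w z) : RootedIso T u x w z := by
  obtain ⟨φ, hu, hx⟩ := h
  obtain ⟨ψ, hv, hy⟩ := k
  exact ⟨φ.trans ψ, by rw [← hv, ← hu]; rfl, fun a => (hy (φ a)).trans (hx a)⟩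

/-- Isomorphism of labelled copies of the rooted graph `(T, o)`. -/
def labelingSetoid (T : SimpleGraph V) (o : V) : Setoid (V → Label) where
  r x y := RootedIso T o x o y
  iseqv := ⟨fun x => RootedIso.refl T o x, RootedIso.symm, RootedIso.trans⟩

/-- `X(T)`: the labelled copies of the rooted graph `(T, o)`, up to isomorphism. -/
def LabeledTrees (T : SimpleGraph V) (o : V) : Type _ := Quotient (labelingSetoid T o)

/-- The class of the labelled rooted graph `(T, o, x)`. -/
def LabeledTrees.mk (T : SimpleGraph V) (o : V) (x : V → Label) : LabeledTrees T o :=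
  Quotient.mk (labelingSetoid T o) x

/-- The quotient σ-algebra. -/
instance (T : SimpleGraph V) (o : V) : MeasurableSpace (LabeledTrees T o) :=
  MeasurableSpace.map (LabeledTrees.mk T o) inferInstance

/-- The law of the class of the i.i.d. labelled tree. -/
def labeledTreesMeasure (T : SimpleGraph V) (o : V) : Measure (LabeledTrees T o) :=
  (iidLabeling V).map (LabeledTrees.mk T o)

/-- `S'(T)`: the classes of `(T, o, x)` and `(T, o, y)` are adjacent if there is a neighbour `v`
of `o` with `(T, v, x) ≅ (T, o, y)`. (Loops are left out.) -/
def fullShiftGraph (T : SimpleGraph V) (o : V) : SimpleGraph (LabeledTrees T o) where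
  Adj p q := p ≠ q ∧ ∃ x y : V → Label, LabeledTrees.mk T o x = p ∧ LabeledTrees.mk T o y = q ∧
    ∃ v, T.Adj o v ∧ RootedIso T v x o y
  symm := ⟨by
    rintro p q ⟨hne, x, y, hx, hy, v, hv, φ, hφ, hxy⟩
    refine ⟨hne.symm, y, x, hy, hx, φ o, ?_, RootedIso.symm ⟨φ, rfl, hxy⟩⟩
    have h := (φ.map_adj_iff).2 hv
    rw [hφ] at h
    exact h.symm⟩
  loopless := ⟨fun _ h => h.1 rfl⟩

/-- `F(T)`: the classes whose connected component in `S'(T)` is a `d`-regular tree. -/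
def freePart (T : SimpleGraph V) (o : V) (d : ℕ) : Set (LabeledTrees T o) :=
  {p | ((fullShiftGraph T o).connectedComponentMk p).toSimpleGraph.IsTree ∧
    ∀ q, (fullShiftGraph T o).Reachable p q → ((fullShiftGraph T o).neighborSet q).encard = d}

/-- `S(T)`: the restriction of `S'(T)` to `F(T)`. -/
def shiftGraph (T : SimpleGraph V) (o : V) (d : ℕ) : SimpleGraph (freePart T o d) :=
  (fullShiftGraph T o).induce (freePart T o d)

/-- The measure that `F(T)` inherits from the coin flip measure. -/
def shiftMeasure (T : SimpleGraph V) (o : V) (d : ℕ) : Measure (freePart T o d) :=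
  (labeledTreesMeasure T o).comap Subtype.val

/-- The `d`-regular tree `T`, with root `o`, admits a factor of i.i.d. homomorphism to the finite
graph `H`: there is a measurable graph homomorphism from `S(T)` to `H`, where measurability is with
respect to the completion of the measure on `F(T)` and the discrete σ-algebra on `H`. -/
def AdmitsFiidHom (T : SimpleGraph V) (o : V) (d : ℕ) {W : Type*} (H : SimpleGraph W) : Prop :=
  ∃ c : shiftGraph T o d →g H,
    ∀ S : Set W, NullMeasurableSet (c ⁻¹' S) (shiftMeasure T o d)

end FactorIID

end

/-! Colour the vertices of the labelled tree measurably and equivariantly with `(d + 1) ^ 3` colours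
so that, over the free part, vertices at distance at most 3 get distinct colours. Then replace each
colour by a pattern: the colour of `u`, and the relation between colours of neighbours of `u` and
colours of their neighbours. Two patterns are joined if they fit like those at the ends of an edge.
The resulting finite graph depends only on the set of colours. It is triangle-free because a pattern
forbids the colour of a neighbour's neighbour from being the colour of a neighbour
(`patternGraph_cliqueFree`).

The colouring is greedy (`exists_measurable_coloring`). It needs nearby vertices to be told apart by
countably many measurable invariants, hence to root non-isomorphic labelled trees. This follows from
the shift component being a regular tree (`eq_of_rootedIso_of_mem_ball`). -/

namespace FactorIID

open Filter

universe u

variable {V : Type u}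

/-! ### Finite balls -/

section Balls

variable (T : SimpleGraph V) [T.LocallyFinite]

open Classical in
/-- The vertices that can be reached from `u` in at most `n` steps. -/
noncomputable def ball : ℕ → V → Finset V
  | 0, u => {u}
  | n + 1, u => (ball n u).biUnion fun a => insert a (T.neighborFinset a)

variable {T}

theorem mem_ball_zero {u w : V} : w ∈ ball T 0 u ↔ w = u := by
  simp [ball]

theorem mem_ball_succ {n : ℕ} {u w : V} :
    w ∈ ball T (n + 1) u ↔ ∃ a ∈ ball T n u, w = a ∨ T.Adj a w := by
  simp [ball]

theorem ball_mono (u : V) : Monotone fun n => ball T n u :=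
  monotone_nat_of_le_succ fun _ a ha => mem_ball_succ.2 ⟨a, ha, Or.inl rfl⟩

theorem mem_ball_self (n : ℕ) (u : V) : u ∈ ball T n u :=
  ball_mono u (Nat.zero_le n) (mem_ball_zero.2 rfl)

theorem mem_ball_three {u w : V} : w ∈ ball T 3 u ↔
    ∃ a b, (a = u ∨ T.Adj u a) ∧ (b = a ∨ T.Adj a b) ∧ (w = b ∨ T.Adj b w) := by
  simp only [mem_ball_succ, mem_ball_zero]
  constructor
  · rintro ⟨b, ⟨a, ⟨_, rfl, ha⟩, hb⟩, hw⟩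
    exact ⟨a, b, ha, hb, hw⟩
  · rintro ⟨a, b, ha, hb, hw⟩
    exact ⟨b, ⟨a, ⟨u, rfl, ha⟩, hb⟩, hw⟩

theorem mem_ball_three_symm {u w : V} (h : w ∈ ball T 3 u) : u ∈ ball T 3 w := by
  obtain ⟨a, b, ha, hb, hw⟩ := mem_ball_three.1 h
  exact mem_ball_three.2 ⟨b, a, hw.imp Eq.symm SimpleGraph.Adj.symm,
    hb.imp Eq.symm SimpleGraph.Adj.symm, ha.imp Eq.symm SimpleGraph.Adj.symm⟩

theorem card_ball_le {d : ℕ} (hd : ∀ v, T.degree v ≤ d) (n : ℕ) (u : V) :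
    (ball T n u).card ≤ (d + 1) ^ n := by
  classical
  induction n with
  | zero => simp [ball]
  | succ n ih =>
    rw [ball, pow_succ]
    refine (Finset.card_biUnion_le_card_mul _ _ (d + 1) fun a _ => ?_).trans
      (Nat.mul_le_mul_right _ ih)
    refine (Finset.card_insert_le _ _).trans (Nat.succ_le_succ ?_)
    simpa using hd a

theorem map_mem_ball {n : ℕ} {u w : V} (φ : T ≃g T) (h : w ∈ ball T n u) :
    φ w ∈ ball T n (φ u) := by
  induction n generalizing w with
  | zero => rw [mem_ball_zero] at h ⊢; rw [h]
  | succ n ih =>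
    obtain ⟨a, ha, hw⟩ := mem_ball_succ.1 h
    exact mem_ball_succ.2 ⟨φ a, ih ha, hw.imp (congrArg φ) (φ.map_adj_iff).2⟩

theorem map_mem_ball_iff {n : ℕ} {u w : V} (φ : T ≃g T) :
    φ w ∈ ball T n (φ u) ↔ w ∈ ball T n u := by
  refine ⟨fun h => ?_, map_mem_ball φ⟩
  simpa using map_mem_ball φ.symm h

theorem exists_mem_ball (hT : T.Connected) (u w : V) : ∃ n, w ∈ ball T n u := by
  obtain ⟨p⟩ := hT.preconnected w u
  induction p with
  | nil => exact ⟨0, mem_ball_zero.2 rfl⟩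
  | cons h _ ih =>
    obtain ⟨n, hn⟩ := ih
    exact ⟨n + 1, mem_ball_succ.2 ⟨_, hn, Or.inr h.symm⟩⟩

theorem countable_of_connected (hT : T.Connected) : Countable V := by
  obtain ⟨o⟩ := hT.nonempty
  rw [← Set.countable_univ_iff]
  refine (Set.countable_iUnion fun n => (ball T n o).countable_toSet).mono fun w _ => ?_
  exact Set.mem_iUnion.2 (exists_mem_ball hT o w)

end Balls

/-! ### Finite approximations to isomorphism -/

section ApproxIso

variable (T : SimpleGraph V) [T.LocallyFinite]

/-- Some automorphism takes `u` to `w` and, on the ball of radius `r`, preserves the first `r` bits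
of the labels. -/
def ApproxIso (r : ℕ) (u : V) (x : V → Label) (w : V) (y : V → Label) : Prop :=
  ∃ φ : T ≃g T, φ u = w ∧ ∀ a ∈ ball T r u, ∀ i < r, y (φ a) i = x a i

variable {T} {r : ℕ} {u v w : V} {x y z : V → Label}

theorem ApproxIso.symm (h : ApproxIso T r u x w y) : ApproxIso T r w y u x := by
  obtain ⟨φ, rfl, h⟩ := h
  refine ⟨φ.symm, φ.symm_apply_apply u, fun a ha i hi => ?_⟩
  have ha' : φ.symm a ∈ ball T r u := by simpa using map_mem_ball φ.symm ha
  simpa using (h _ ha' i hi).symm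

theorem ApproxIso.trans (h : ApproxIso T r u x v y) (k : ApproxIso T r v y w z) :
    ApproxIso T r u x w z := by
  obtain ⟨φ, rfl, h⟩ := h
  obtain ⟨ψ, rfl, k⟩ := k
  exact ⟨φ.trans ψ, rfl, fun a ha i hi => (k _ (map_mem_ball φ ha) i hi).trans (h a ha i hi)⟩

theorem ApproxIso.mono {s : ℕ} (hrs : r ≤ s) (h : ApproxIso T s u x w y) :
    ApproxIso T r u x w y := by
  obtain ⟨φ, hu, h⟩ := h
  exact ⟨φ, hu, fun a ha i hi => h a (ball_mono u hrs ha) i (hi.trans_le hrs)⟩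

theorem RootedIso.approxIso (h : RootedIso T u x w y) (r : ℕ) : ApproxIso T r u x w y := by
  obtain ⟨φ, hu, h⟩ := h
  exact ⟨φ, hu, fun a _ i _ => congrFun (h a) i⟩

/-- All images of `a` lie in one finite ball around `w`, so the ultrafilter selects one. -/
theorem exists_eventually_eq (hT : T.Connected) (U : Ultrafilter ℕ) {u w : V}
    {φ : ℕ → T ≃g T} (hφ : ∀ r, φ r u = w) (a : V) : ∃ b, ∀ᶠ r in (U : Filter ℕ), φ r a = b := by
  obtain ⟨n, hn⟩ := exists_mem_ball hT u a
  have h : ∀ᶠ r in (U : Filter ℕ), ∃ b ∈ (ball T n w : Set V), φ r a = b :=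
    Eventually.of_forall fun r => ⟨φ r a, by rw [← hφ r]; exact map_mem_ball (φ r) hn, rfl⟩
  obtain ⟨b, -, hb⟩ := (Ultrafilter.eventually_exists_mem_iff (ball T n w).finite_toSet).1 h
  exact ⟨b, hb⟩

/-- Compactness: the approximate isomorphisms and their inverses converge pointwise along an
ultrafilter, to mutually inverse maps. -/
theorem rootedIso_of_forall_approxIso (hT : T.Connected) (h : ∀ r, ApproxIso T r u x w y) :
    RootedIso T u x w y := by
  choose φ hu hx using h
  let U : Ultrafilter ℕ := hyperfilter ℕ
  have hU : ∀ n, ∀ᶠ r in (U : Filter ℕ), n ≤ r := fun n =>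
    Nat.hyperfilter_le_atTop (eventually_ge_atTop n)
  choose f hf using exists_eventually_eq hT U hu
  choose g hg using exists_eventually_eq hT U (φ := fun r => (φ r).symm) (u := w) (w := u)
    fun r => by rw [← hu r]; exact (φ r).symm_apply_apply u
  have hfg : ∀ b, f (g b) = b := fun b => by
    obtain ⟨r, h₁, h₂⟩ := ((hf (g b)).and (hg b)).exists
    rw [← h₁, ← h₂]; exact (φ r).apply_symm_apply b
  have hgf : ∀ a, g (f a) = a := fun a => by
    obtain ⟨r, h₁, h₂⟩ := ((hg (f a)).and (hf a)).exists
    rw [← h₁, ← h₂]; exact (φ r).symm_apply_apply a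
  refine ⟨⟨⟨f, g, hgf, hfg⟩, fun {a b} => ?_⟩, ?_, fun a => funext fun i => ?_⟩
  · obtain ⟨r, h₁, h₂⟩ := ((hf a).and (hf b)).exists
    change T.Adj (f a) (f b) ↔ _
    rw [← h₁, ← h₂]; exact (φ r).map_adj_iff
  · obtain ⟨r, h₁⟩ := (hf u).exists
    exact h₁.symm.trans (hu r)
  · obtain ⟨n, hn⟩ := exists_mem_ball hT u a
    obtain ⟨r, h₁, h₂, h₃⟩ := ((hf a).and ((hU n).and (hU (i + 1)))).exists
    change y (f a) i = x a i
    rw [← h₁]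
    exact hx r a (ball_mono u h₂ hn) i h₃

/-- The condition depends on only finitely many bits of `x`. -/
theorem measurable_approxIso (r : ℕ) (u w : V) (y : V → Label) :
    Measurable fun x : V → Label => ApproxIso T r u x w y := by
  let g : (V → Label) → (ball T r u × Fin r → Bool) := fun x p => x p.1 p.2
  have hg : Measurable g := measurable_pi_lambda _ fun p =>
    (measurable_pi_apply (p.2 : ℕ)).comp (measurable_pi_apply (p.1 : V))
  let S : (ball T r u × Fin r → Bool) → Prop := fun s =>
    ∃ φ : T ≃g T, φ u = w ∧ ∀ p, y (φ p.1) p.2 = s p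
  have hS : Measurable S := .of_discrete
  convert hS.comp hg using 2 with x
  refine exists_congr fun φ => and_congr_right fun _ => ?_
  exact ⟨fun h p => h p.1 p.1.2 p.2 p.2.2, fun h a ha i hi => h (⟨a, ha⟩, ⟨i, hi⟩)⟩

end ApproxIso

/-! ### Separating invariants -/

section Separation

variable (T : SimpleGraph V) [T.LocallyFinite]

/-- A countable family of measurable invariants of rooted labelled graphs that separates the
vertices of a labelled graph from those around them. -/
theorem exists_separating_invariants (hT : T.Connected) :
    ∃ P : ℕ → (V → Label) → V → Prop,
      (∀ m x y u w, RootedIso T u x w y → (P m x u ↔ P m y w)) ∧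
      (∀ m u, Measurable fun x => P m x u) ∧
      ∀ x u (s : Finset V), (∀ w ∈ s, ¬ RootedIso T u x w x) →
        ∃ m, P m x u ∧ ∀ w ∈ s, ¬ P m x w := by
  classical
  have := countable_of_connected hT
  have := hT.nonempty
  obtain ⟨e, he⟩ := exists_surjective_nat (ℕ × V × Finset (V × ℕ))
  let lab : Finset (V × ℕ) → V → Label := fun s a i => decide ((a, i) ∈ s)
  refine ⟨fun m x u => ApproxIso T (e m).1 u x (e m).2.1 (lab (e m).2.2), ?_, ?_, ?_⟩
  · intro m x y u w h
    exact ⟨(h.symm.approxIso _).trans, (h.approxIso _).trans⟩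
  · intro m u
    exact measurable_approxIso _ _ _ _
  · intro x u s hs
    have h : ∀ w ∈ s, ∃ r, ¬ ApproxIso T r u x w x := fun w hw => by
      by_contra! h
      exact hs w hw (rootedIso_of_forall_approxIso hT h)
    choose! ρ hρ using h
    -- The invariant records the true bits of `x` around `u`, to a depth that separates `u` from
    -- every vertex of `s` at once.
    obtain ⟨m, hm⟩ := he (s.sup ρ, u,
      (ball T (s.sup ρ) u ×ˢ Finset.range (s.sup ρ)).filter fun p => x p.1 p.2 = true)
    have hu : ApproxIso T (e m).1 u x (e m).2.1 (lab (e m).2.2) := by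
      rw [hm]
      refine ⟨RelIso.refl _, rfl, fun a ha i hi => ?_⟩
      simp [lab, ha, hi]
    refine ⟨m, hu, fun w hw h => hρ w hw ?_⟩
    refine (hu.trans h.symm).mono ?_
    rw [hm]
    exact Finset.le_sup hw

end Separation

/-! ### Greedy colouring by rank -/

section Greedy

/-- A colour outside `s`, if there is one. -/
noncomputable def freshColor {k : ℕ} [NeZero k] (s : Set (Fin k)) : Fin k :=
  open Classical in if h : ∃ i, i ∉ s then h.choose else 0

theorem freshColor_notMem {k : ℕ} [NeZero k] {s : Set (Fin k)} (h : ∃ i, i ∉ s) :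
    freshColor s ∉ s := by
  rw [freshColor, dif_pos h]
  exact h.choose_spec

variable (T : SimpleGraph V) [T.LocallyFinite]

open Classical in
/-- The vertices other than `u` that can be reached from `u` in at most three steps. -/
noncomputable def near (u : V) : Finset V := (ball T 3 u).erase u

variable {T}

theorem mem_near {u w : V} : w ∈ near T u ↔ w ≠ u ∧ w ∈ ball T 3 u := by
  simp [near]

theorem mem_near_symm {u w : V} (h : w ∈ near T u) : u ∈ near T w :=
  mem_near.2 ⟨(mem_near.1 h).1.symm, mem_ball_three_symm (mem_near.1 h).2⟩

theorem card_near_lt {d : ℕ} (hd : ∀ v, T.degree v ≤ d) (u : V) :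
    (near T u).card < (d + 1) ^ 3 := by
  classical
  exact (Finset.card_erase_lt_of_mem (mem_ball_self 3 u)).trans_le (card_ball_le hd 3 u)

theorem map_mem_near_iff {u w : V} (φ : T ≃g T) : φ w ∈ near T (φ u) ↔ w ∈ near T u := by
  rw [mem_near, mem_near, map_mem_ball_iff, φ.injective.ne_iff]

variable (T) (P : ℕ → (V → Label) → V → Prop)

/-- The property `P m` tells `u` apart from the vertices near it. -/
def Isolates (m : ℕ) (x : V → Label) (u : V) : Prop :=
  P m x u ∧ ∀ w ∈ near T u, ¬ P m x w

open Classical in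
/-- The first property that tells `u` apart from the vertices near it. -/
noncomputable def rank (x : V → Label) (u : V) : ℕ :=
  if h : ∃ m, Isolates T P m x u then Nat.find h else 0

open Classical in
/-- The greedy colouring, after the vertices of rank less than `m` got their colours. -/
noncomputable def stage (k : ℕ) [NeZero k] : ℕ → (V → Label) → V → Fin k
  | 0, _, _ => 0
  | m + 1, x, u =>
    if rank T P x u = m then freshColor (stage k m x '' near T u) else stage k m x u

/-- The greedy colouring. -/
noncomputable def greedy (k : ℕ) [NeZero k] (x : V → Label) (u : V) : Fin k :=
  stage T P k (rank T P x u + 1) x u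

variable {T P} {k : ℕ} [NeZero k]

theorem stage_eq_greedy {m : ℕ} {x : V → Label} {u : V} (h : rank T P x u < m) :
    stage T P k m x u = greedy T P k x u := by
  induction m, h using Nat.le_induction with
  | base => rfl
  | succ m hm ih =>
    rw [stage, if_neg (by omega), ih]

/-- When `u` is coloured, `w` already has its final colour. Vertices not yet treated show the
default 0; avoiding it too is harmless, since fewer than `k` vertices are near `u`. -/
theorem greedy_ne_of_rank_lt (hk : ∀ u, (near T u).card < k) {x : V → Label} {u w : V}
    (hw : w ∈ near T u) (h : rank T P x w < rank T P x u) :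
    greedy T P k x u ≠ greedy T P k x w := by
  classical
  rw [← stage_eq_greedy h, greedy, stage, if_pos rfl]
  have hs : ∃ i, i ∉ stage T P k (rank T P x u) x '' (near T u : Set V) := by
    by_contra! hs
    have h₁ : Finset.univ ⊆ (near T u).image (stage T P k (rank T P x u) x) := fun i _ => by
      simpa using hs i
    have h₂ := (Finset.card_le_card h₁).trans Finset.card_image_le
    rw [Finset.card_univ, Fintype.card_fin] at h₂
    exact absurd (hk u) h₂.not_gt
  exact fun heq => freshColor_notMem hs (heq ▸ Set.mem_image_of_mem _ hw)

theorem isolates_rank {x : V → Label} {u : V} (h : ∃ m, Isolates T P m x u) :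
    Isolates T P (rank T P x u) x u := by
  classical
  rw [rank, dif_pos h]
  exact Nat.find_spec h

/-- Nearby vertices never share a rank: the isolating property of one fails at the other. So one is
coloured after the other. -/
theorem greedy_ne (hk : ∀ u, (near T u).card < k) {x : V → Label}
    (hx : ∀ u, ∃ m, Isolates T P m x u) {u w : V} (hw : w ∈ near T u) :
    greedy T P k x u ≠ greedy T P k x w := by
  rcases lt_trichotomy (rank T P x w) (rank T P x u) with h | h | h
  · exact greedy_ne_of_rank_lt hk hw h
  · have h₁ := (isolates_rank (hx u)).2 w hw
    rw [← h] at h₁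
    exact absurd (isolates_rank (hx w)).1 h₁
  · exact (greedy_ne_of_rank_lt hk (mem_near_symm hw) h).symm

section Equivariance

variable (hP : ∀ m x y u w, RootedIso T u x w y → (P m x u ↔ P m y w))
  {x y : V → Label} {φ : T ≃g T} (hφ : ∀ u, y (φ u) = x u)

include hP hφ

theorem isolates_map (m : ℕ) (u : V) : Isolates T P m y (φ u) ↔ Isolates T P m x u := by
  have h : ∀ w, P m x w ↔ P m y (φ w) := fun w => hP m x y w (φ w) ⟨φ, rfl, hφ⟩
  refine and_congr (h u).symm (φ.surjective.forall.trans (forall_congr' fun w => ?_))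
  rw [map_mem_near_iff, h]

theorem rank_map (u : V) : rank T P y (φ u) = rank T P x u := by
  classical
  simp only [rank, isolates_map hP hφ]

/-- The fresh colour is a function of the set of colours to avoid, so no choice depends on the
vertex. -/
theorem stage_map (m : ℕ) (u : V) : stage T P k m y (φ u) = stage T P k m x u := by
  induction m generalizing u with
  | zero => rfl
  | succ m ih =>
    have h : stage T P k m y '' near T (φ u) = stage T P k m x '' near T u := by
      ext i
      constructor
      · rintro ⟨w, hw, rfl⟩
        obtain ⟨v, rfl⟩ := φ.surjective w
        exact ⟨v, (map_mem_near_iff φ).1 hw, (ih v).symm⟩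
      · rintro ⟨v, hv, rfl⟩
        exact ⟨φ v, (map_mem_near_iff φ).2 hv, ih v⟩
    rw [stage, stage, rank_map hP hφ, h, ih]

theorem greedy_map (u : V) : greedy T P k y (φ u) = greedy T P k x u := by
  rw [greedy, greedy, rank_map hP hφ, stage_map hP hφ]

end Equivariance

section Measurability

variable [Countable V] (hP : ∀ m u, Measurable fun x => P m x u)

include hP

theorem measurable_isolates (m : ℕ) (u : V) : Measurable fun x => Isolates T P m x u :=
  (hP m u).and (.forall fun w => .imp measurable_const (hP m w).not)

theorem measurable_rank (u : V) : Measurable fun x => rank T P x u := by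
  classical
  refine measurable_to_countable' fun n => ?_
  -- The second disjunct accounts for the default rank 0.
  have h : ∀ x, rank T P x u = n ↔ (Isolates T P n x u ∧ ∀ j, j < n → ¬ Isolates T P j x u) ∨
      (n = 0 ∧ ∀ j, ¬ Isolates T P j x u) := fun x => by
    by_cases hx : ∃ m, Isolates T P m x u
    · rw [rank, dif_pos hx, Nat.find_eq_iff]
      exact ⟨Or.inl, fun h => h.resolve_right fun h => hx.elim h.2⟩
    · rw [rank, dif_neg hx]
      push Not at hx
      simp [hx, eq_comm]
  have hm := measurable_isolates (T := T) hP (u := u)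
  change MeasurableSet {x | rank T P x u = n}
  simp only [h]
  exact (((hm n).and (.forall fun j => .imp measurable_const (hm j).not)).or
    (measurable_const.and (.forall fun j => (hm j).not))).setOf

theorem measurable_stage (m : ℕ) (u : V) : Measurable fun x => stage T P k m x u := by
  classical
  induction m generalizing u with
  | zero => exact measurable_const
  | succ m ih =>
    simp only [stage]
    refine Measurable.ite (measurable_rank hP u (measurableSet_singleton m)) ?_ (ih u)
    let g : (near T u → Fin k) → Fin k := fun s => freshColor (Set.range s)
    have hg : Measurable g := .of_discrete
    convert hg.comp (measurable_pi_lambda (fun x (w : near T u) => stage T P k m x w)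
      fun w => ih w) using 2 with x
    simp only [g, Function.comp, Set.image_eq_range]
    rfl

theorem measurable_greedy (u : V) : Measurable fun x => greedy T P k x u := by
  refine measurable_to_countable' fun i => ?_
  have h : (fun x => greedy T P k x u) ⁻¹' {i} =
      {x | ∃ m, rank T P x u = m ∧ stage T P k (m + 1) x u = i} := by
    ext x
    simp [greedy]
  rw [h]
  refine (Measurable.exists fun m => .and ?_ ?_).setOf
  · exact measurableSet_setOfPred.1 (measurable_rank hP u (measurableSet_singleton m))
  · exact measurableSet_setOfPred.1 (measurable_stage hP (m + 1) u (measurableSet_singleton i))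

end Measurability

end Greedy

/-- A measurable equivariant colouring with `(d + 1) ^ 3` colours which, on labelled graphs without
local symmetries, gives distinct colours to vertices at distance at most three. -/
theorem exists_measurable_coloring (T : SimpleGraph V) [T.LocallyFinite] (hT : T.Connected) {d : ℕ}
    (hd : ∀ v, T.degree v ≤ d) :
    ∃ c : (V → Label) → V → Fin ((d + 1) ^ 3),
      (∀ x y (φ : T ≃g T), (∀ u, y (φ u) = x u) → ∀ u, c y (φ u) = c x u) ∧
      (∀ u, Measurable fun x => c x u) ∧
      ∀ x, (∀ u w, w ∈ ball T 3 u → RootedIso T u x w x → w = u) →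
        ∀ u w, w ∈ ball T 3 u → c x u = c x w → w = u := by
  have := countable_of_connected hT
  obtain ⟨P, hinv, hmeas, hsep⟩ := exists_separating_invariants T hT
  refine ⟨greedy T P _, fun x y φ hφ => greedy_map hinv hφ, measurable_greedy hmeas,
    fun x hx u w hw hc => by_contra fun hne => ?_⟩
  refine greedy_ne (card_near_lt hd) (fun u => hsep x u (near T u) fun w hw h => ?_)
    (mem_near.2 ⟨hne, hw⟩) hc
  exact (mem_near.1 hw).1 (hx u w (mem_near.1 hw).2 h)

/-! ### No local symmetries over the free part -/

section FreePart

variable {T : SimpleGraph V} {o : V} {d : ℕ}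

theorem mk_eq_mk {x y : V → Label} :
    LabeledTrees.mk T o x = LabeledTrees.mk T o y ↔ RootedIso T o x o y :=
  Quotient.eq (r := labelingSetoid T o)

theorem exists_adj_rootedIso {y : V → Label} {q : LabeledTrees T o}
    (h : (fullShiftGraph T o).Adj (LabeledTrees.mk T o y) q) :
    ∃ v, T.Adj o v ∧ ∃ y', LabeledTrees.mk T o y' = q ∧ RootedIso T v y o y' := by
  obtain ⟨-, x, y', hx, hy', v, hv, hxy⟩ := h
  obtain ⟨φ, ho, hφ⟩ := mk_eq_mk.1 hx
  refine ⟨φ v, ?_, y', hy', RootedIso.trans (RootedIso.symm ⟨φ, rfl, hφ⟩) hxy⟩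
  have := (φ.map_adj_iff).2 hv
  rwa [ho] at this

theorem mem_freePart_of_adj {p q : LabeledTrees T o} (hp : p ∈ freePart T o d)
    (h : (fullShiftGraph T o).Adj p q) : q ∈ freePart T o d := by
  refine ⟨?_, fun r hr => hp.2 r (h.reachable.trans hr)⟩
  rw [← SimpleGraph.ConnectedComponent.sound h.reachable]
  exact hp.1

theorem not_adj_of_adj_of_adj {p q r : LabeledTrees T o} (hp : p ∈ freePart T o d)
    (hpq : (fullShiftGraph T o).Adj p q) (hqr : (fullShiftGraph T o).Adj q r) :
    ¬ (fullShiftGraph T o).Adj r p := fun hrp => by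
  classical
  have hq := SimpleGraph.ConnectedComponent.sound hpq.reachable
  have hr := SimpleGraph.ConnectedComponent.sound hrp.reachable
  let C := (fullShiftGraph T o).connectedComponentMk p
  let p' : C := ⟨p, rfl⟩
  let q' : C := ⟨q, hq.symm⟩
  let r' : C := ⟨r, hr⟩
  refine hp.1.isAcyclic.cliqueFree le_rfl {p', q', r'} ?_
  rw [SimpleGraph.is3Clique_triple_iff]
  exact ⟨hpq, hrp.symm, hqr⟩

/-- The neighbours of the root of a labelled graph in the free part correspond to those of its
class. -/
theorem exists_equiv_neighborSet [T.LocallyFinite] (ho : T.degree o = d) {y : V → Label}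
    (hy : LabeledTrees.mk T o y ∈ freePart T o d) :
    ∃ f : (fullShiftGraph T o).neighborSet (LabeledTrees.mk T o y) → T.neighborSet o,
      Function.Bijective f ∧ ∀ q, ∃ y', LabeledTrees.mk T o y' = q.1 ∧ RootedIso T (f q) y o y' := by
  choose f hf g hg hfg using fun q : (fullShiftGraph T o).neighborSet (LabeledTrees.mk T o y) =>
    exists_adj_rootedIso q.2
  have hcard := hy.2 _ (SimpleGraph.Reachable.refl _)
  have : Finite ((fullShiftGraph T o).neighborSet (LabeledTrees.mk T o y)) :=
    Set.finite_of_encard_eq_coe hcard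
  have := Fintype.ofFinite ((fullShiftGraph T o).neighborSet (LabeledTrees.mk T o y))
  -- A neighbour of `o` determines the class seen from it, and both sides have `d` elements.
  refine ⟨fun q => ⟨f q, hf q⟩, (Fintype.bijective_iff_injective_and_card _).2 ⟨?_, ?_⟩,
    fun q => ⟨g q, hg q, hfg q⟩⟩
  · intro q q' h
    have h' : f q = f q' := congrArg Subtype.val h
    refine Subtype.ext ?_
    rw [← hg q, ← hg q', mk_eq_mk]
    exact RootedIso.trans (RootedIso.symm (hfg q)) (h' ▸ hfg q')
  · rw [T.card_neighborSet_eq_degree, ho, ← Nat.card_eq_fintype_card]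
    exact congrArg ENat.toNat hcard

/-- The labelled graph `(T, u, x)` is isomorphic to one in the free part. -/
def IsFreeAt (T : SimpleGraph V) (o : V) (d : ℕ) (x : V → Label) (u : V) : Prop :=
  ∃ y, RootedIso T u x o y ∧ LabeledTrees.mk T o y ∈ freePart T o d

variable [T.LocallyFinite] {x y : V → Label} {u v w : V}

/-- By surjectivity of the bijection, steps in `T` project to edges of the shift graph, never to a
standstill. -/
theorem exists_adj_of_adj (ho : T.degree o = d) (hy : LabeledTrees.mk T o y ∈ freePart T o d)
    (hu : RootedIso T u x o y) (h : T.Adj u v) :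
    ∃ y', RootedIso T v x o y' ∧ LabeledTrees.mk T o y' ∈ freePart T o d ∧
      (fullShiftGraph T o).Adj (LabeledTrees.mk T o y) (LabeledTrees.mk T o y') := by
  obtain ⟨f, hf, hfy⟩ := exists_equiv_neighborSet ho hy
  obtain ⟨φ, hφ, hxy⟩ := hu
  have hv : T.Adj o (φ v) := by rw [← hφ]; exact (φ.map_adj_iff).2 h
  obtain ⟨q, hq⟩ := hf.2 ⟨φ v, hv⟩
  obtain ⟨y', hy', hiso⟩ := hfy q
  rw [hq] at hiso
  have hadj : (fullShiftGraph T o).Adj (LabeledTrees.mk T o y) (LabeledTrees.mk T o y') :=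
    hy' ▸ q.2
  exact ⟨y', RootedIso.trans ⟨φ, rfl, hxy⟩ hiso, mem_freePart_of_adj hy hadj, hadj⟩

theorem isFreeAt_of_connected (hT : T.Connected) (ho : T.degree o = d)
    (hx : LabeledTrees.mk T o x ∈ freePart T o d) (u : V) : IsFreeAt T o d x u := by
  obtain ⟨p⟩ := hT.preconnected u o
  induction p with
  | nil => exact ⟨x, RootedIso.refl _ _ _, hx⟩
  | cons h _ ih =>
    obtain ⟨y, hy, hF⟩ := ih ho hx
    obtain ⟨y', hy', hF', -⟩ := exists_adj_of_adj ho hF hy h.symm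
    exact ⟨y', hy', hF'⟩

theorem not_rootedIso_of_adj (ho : T.degree o = d) (hu : IsFreeAt T o d x u) (h : T.Adj u w) :
    ¬ RootedIso T u x w x := fun hiso => by
  obtain ⟨y, hy, hF⟩ := hu
  obtain ⟨y', hy', -, hadj⟩ := exists_adj_of_adj ho hF hy h
  exact hadj.ne (mk_eq_mk.2 ((hy.symm.trans hiso).trans hy'))

theorem eq_of_rootedIso_of_adj (ho : T.degree o = d) (hu : IsFreeAt T o d x u) (hv : T.Adj u v)
    (hw : T.Adj u w) (hiso : RootedIso T v x w x) : v = w := by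
  obtain ⟨y, ⟨φ, hφ, hxy⟩, hF⟩ := hu
  obtain ⟨f, hf, hfy⟩ := exists_equiv_neighborSet ho hF
  have hv' : T.Adj o (φ v) := by rw [← hφ]; exact (φ.map_adj_iff).2 hv
  have hw' : T.Adj o (φ w) := by rw [← hφ]; exact (φ.map_adj_iff).2 hw
  obtain ⟨q, hq⟩ := hf.2 ⟨φ v, hv'⟩
  obtain ⟨r, hr⟩ := hf.2 ⟨φ w, hw'⟩
  obtain ⟨y₁, h₁, hiso₁⟩ := hfy q
  obtain ⟨y₂, h₂, hiso₂⟩ := hfy r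
  rw [hq] at hiso₁
  rw [hr] at hiso₂
  have hqr : q = r := Subtype.ext <| by
    rw [← h₁, ← h₂, mk_eq_mk]
    refine hiso₁.symm.trans (RootedIso.trans ?_ hiso₂)
    exact (RootedIso.symm ⟨φ, rfl, hxy⟩).trans (hiso.trans ⟨φ, rfl, hxy⟩)
  rw [hqr, hr] at hq
  exact φ.injective (congrArg Subtype.val hq).symm

/-- Otherwise the three steps would project to a triangle in a component that is a tree. -/
theorem not_rootedIso_of_adj₃ (ho : T.degree o = d) (hu : IsFreeAt T o d x u) (huv : T.Adj u v)
    {v' : V} (hvv : T.Adj v v') (hvw : T.Adj v' w) : ¬ RootedIso T u x w x := fun hiso => by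
  obtain ⟨y, hy, hF⟩ := hu
  obtain ⟨y₁, h₁, hF₁, hadj₁⟩ := exists_adj_of_adj ho hF hy huv
  obtain ⟨y₂, h₂, hF₂, hadj₂⟩ := exists_adj_of_adj ho hF₁ h₁ hvv
  obtain ⟨y₃, h₃, -, hadj₃⟩ := exists_adj_of_adj ho hF₂ h₂ hvw
  rw [mk_eq_mk.2 ((h₃.symm.trans hiso.symm).trans hy)] at hadj₃
  exact not_adj_of_adj_of_adj hF hadj₁ hadj₂ hadj₃

theorem eq_of_rootedIso_of_mem_ball (ho : T.degree o = d) (hx : ∀ u, IsFreeAt T o d x u)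
    (hw : w ∈ ball T 3 u) (hiso : RootedIso T u x w x) : w = u := by
  have h₂ : ∀ {a b c : V}, T.Adj a b → T.Adj b c → RootedIso T a x c x → c = a :=
    fun hab hbc h => (eq_of_rootedIso_of_adj ho (hx _) hab.symm hbc h).symm
  obtain ⟨a, b, rfl | ha, rfl | hb, rfl | hw⟩ := mem_ball_three.1 hw
  · rfl
  · exact absurd hiso (not_rootedIso_of_adj ho (hx _) hw)
  · exact absurd hiso (not_rootedIso_of_adj ho (hx _) hb)
  · exact h₂ hb hw hiso
  · exact absurd hiso (not_rootedIso_of_adj ho (hx _) ha)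
  · exact h₂ ha hw hiso
  · exact h₂ ha hb hiso
  · exact absurd hiso (not_rootedIso_of_adj₃ ho (hx _) ha hb hw)

end FreePart

/-! ### The triangle-free target graph -/

section PatternGraph

/-- A vertex of the pattern graph: the colour of a vertex, and the relation that holds between the
colour of each of its neighbours and the colours of their neighbours. -/
abbrev Pattern (C : Type*) : Type _ := C × (C → C → Prop)

/-- The pattern of the vertex `u` in a graph coloured by `c`. -/
def pattern {C : Type*} (T : SimpleGraph V) (c : V → C) (u : V) : Pattern C :=
  (c u, fun i j => ∃ v w, T.Adj u v ∧ T.Adj v w ∧ c v = i ∧ c w = j)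

/-- The patterns `p` and `q` fit together: they agree on the colours around an edge. -/
structure Pattern.Fits {C : Type*} (p q : Pattern C) : Prop where
  not_dom : ∀ i j, p.2 i j → ¬ ∃ k, p.2 j k
  dom : ∃ k, p.2 q.1 k
  of_dom : ∀ i, (∃ j, q.2 i j) → p.2 q.1 i

/-- The graph of patterns; edges are the pairs that fit together both ways. -/
def patternGraph (C : Type*) : SimpleGraph (Pattern C) where
  Adj p q := p.Fits q ∧ q.Fits p
  symm := ⟨fun _ _ h => ⟨h.2, h.1⟩⟩
  loopless := ⟨fun _ h => h.1.not_dom _ _ (h.1.of_dom _ h.1.dom) h.1.dom⟩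

/-- In a triangle `p`, `q`, `r`, the colour of `r` is in the domain of `p.2` because `p` fits `r`,
yet is related to that of `q` because `q` fits `r`; `not_dom` excludes this. -/
theorem patternGraph_cliqueFree (C : Type*) : (patternGraph C).CliqueFree 3 := by
  classical
  intro s hs
  obtain ⟨p, q, r, hpq, hpr, hqr, -⟩ := SimpleGraph.is3Clique_iff.1 hs
  exact hpq.1.not_dom _ _ (hpq.1.of_dom _ hqr.1.dom) hpr.1.dom

variable {C : Type*} {T : SimpleGraph V} {c : V → C}

theorem pattern_fits [T.LocallyFinite] (hT : T.IsAcyclic) (hc : ∀ u w, w ∈ ball T 3 u → c u = c w → w = u) {u v : V}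
    (h : T.Adj u v) : (pattern T c u).Fits (pattern T c v) where
  not_dom := by
    classical
    rintro _ _ ⟨a, b, hua, hab, rfl, rfl⟩ ⟨_, a', _, hua', -, ha', -⟩
    have hb : b ∈ ball T 3 a' :=
      mem_ball_three.2 ⟨u, a, Or.inr hua'.symm, Or.inr hua, Or.inr hab⟩
    -- A neighbour and a second neighbour of `u` are at distance at most 3, so equal colours make
    -- them equal, which closes a triangle.
    obtain rfl := hc _ _ hb ha'
    refine hT.cliqueFree le_rfl {u, a, b} ?_
    exact SimpleGraph.is3Clique_triple_iff.2 ⟨hua, hua', hab⟩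
  dom := ⟨_, v, u, h, h.symm, rfl, rfl⟩
  of_dom := by
    rintro _ ⟨_, w, _, hvw, -, rfl, -⟩
    exact ⟨v, w, h, hvw, rfl, rfl⟩

theorem pattern_map {c' : V → C} (φ : T ≃g T) (h : ∀ u, c' (φ u) = c u) (u : V) :
    pattern T c' (φ u) = pattern T c u := by
  refine Prod.ext (h u) (funext₂ fun i j => propext ?_)
  constructor
  · rintro ⟨v, w, hv, hw, rfl, rfl⟩
    obtain ⟨v, rfl⟩ := φ.surjective v
    obtain ⟨w, rfl⟩ := φ.surjective w
    exact ⟨v, w, (φ.map_adj_iff).1 hv, (φ.map_adj_iff).1 hw, (h v).symm, (h w).symm⟩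
  · rintro ⟨v, w, hv, hw, rfl, rfl⟩
    exact ⟨φ v, φ w, (φ.map_adj_iff).2 hv, (φ.map_adj_iff).2 hw, h v, h w⟩

theorem measurable_pattern [Countable V] [MeasurableSpace C] [MeasurableSingletonClass C]
    {X : Type*} [MeasurableSpace X] {c : X → V → C} (hc : ∀ u, Measurable fun x => c x u) (u : V) :
    Measurable fun x => pattern T (c x) u := by
  have h : ∀ v i, Measurable fun x => c x v = i := fun v i =>
    measurableSet_setOfPred.1 (hc v (measurableSet_singleton i))
  refine (hc u).prodMk (measurable_pi_lambda _ fun i => measurable_pi_lambda _ fun j => ?_)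
  exact .exists fun v => .exists fun w =>
    measurable_const.and (measurable_const.and ((h v i).and (h w j)))

end PatternGraph

/-! ### The factor map -/

theorem admitsFiidHom_patternGraph (T : SimpleGraph V) [T.LocallyFinite] (hT : T.IsTree) {d : ℕ}
    (hd : T.IsRegularOfDegree d) (o : V) :
    AdmitsFiidHom T o d (patternGraph (Fin ((d + 1) ^ 3))) := by
  have := countable_of_connected hT.connected
  obtain ⟨c, hmap, hmeas, hne⟩ := exists_measurable_coloring T hT.connected fun v => (hd v).le
  let f : LabeledTrees T o → Pattern (Fin ((d + 1) ^ 3)) :=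
    Quotient.lift (fun x => pattern T (c x) o) fun x y ⟨φ, ho, hφ⟩ => by
      have h := pattern_map φ (hmap x y φ hφ) o
      rw [ho] at h
      exact h.symm
  -- Measurability in the quotient is that of the pullback to labellings, so no null set is
  -- discarded.
  have hf : ∀ S, MeasurableSet (f ⁻¹' S) := fun S =>
    measurable_pattern hmeas o (.of_discrete : MeasurableSet S)
  refine ⟨⟨fun p => f p, ?_⟩, fun S =>
    (measurable_subtype_coe (hf S)).nullMeasurableSet⟩
  rintro ⟨p, hp⟩ ⟨q, hq⟩ hpq
  obtain ⟨-, x, y, rfl, rfl, v, hv, φ, hφ, hxy⟩ : (fullShiftGraph T o).Adj p q := hpq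
  have hfits {u v : V} := pattern_fits (c := c x) (u := u) (v := v) hT.isAcyclic <| hne x fun u w =>
    eq_of_rootedIso_of_mem_ball (hd o) (isFreeAt_of_connected hT.connected (hd o) hp)
  have hy : pattern T (c y) o = pattern T (c x) v := by
    rw [← hφ]
    exact pattern_map φ (hmap x y φ hxy) v
  change (patternGraph _).Adj (pattern T (c x) o) (pattern T (c y) o)
  rw [hy]
  exact ⟨hfits hv, hfits hv.symm⟩

theorem AdmitsFiidHom.of_hom {T : SimpleGraph V} {o : V} {d : ℕ} {W W' : Type*}
    {H : SimpleGraph W} {H' : SimpleGraph W'} (h : AdmitsFiidHom T o d H) (g : H →g H') :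
    AdmitsFiidHom T o d H' := by
  obtain ⟨c, hc⟩ := h
  exact ⟨g.comp c, fun S => hc (g ⁻¹' S)⟩

end FactorIID

theorem mainTheorem5 :
    ∃ (n : ℕ) (H : SimpleGraph (Fin n)), H.CliqueFree 3 ∧
      ∀ (V : Type*) (T : SimpleGraph V) [T.LocallyFinite],
        T.IsTree → T.IsRegularOfDegree 3 → ∀ o : V, FactorIID.AdmitsFiidHom T o 3 H := by
  obtain ⟨n, ⟨e⟩⟩ := Finite.exists_equiv_fin (FactorIID.Pattern (Fin ((3 + 1) ^ 3)))
  let G := FactorIID.patternGraph (Fin ((3 + 1) ^ 3))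
  refine ⟨n, G.map e.toEmbedding, ?_, fun V T _ hT hd o => ?_⟩
  · exact (FactorIID.patternGraph_cliqueFree _).comap ⟨(SimpleGraph.Iso.map e G).symm.toCopy⟩
  · exact (FactorIID.admitsFiidHom_patternGraph T hT hd o).of_hom (SimpleGraph.Iso.map e G).toHom
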